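/- Let $(X,\mathscr A)$ be a measurable space and $\mu$ a probability measure on it. Let $\mathcal M$ be the ring of all real-valued measurable functions on $X$; for $f\in\mathcal M$ put $Z(f)=\{x\in X: f(x)=0\}$, and let $\mathcal M_\delta$ be $\mathcal M$ with the topology of the pseudometric $\delta(f,g)=\mu(X\setminus Z(f-g))$. An atom of a measure $\nu$ on $\mathscr A$ is a set $A\in\mathscr A$ with $\nu(A)>0$ such that for every $B\in\mathscr A$ either $\nu(A\cap B)=0$ or $\nu(A\setminus B)=0$; $\nu$ is purely atomic if every $E\in\mathscr A$ with $\nu(E)>0$ contains an atom, and non-atomic if it has no atoms. For measures $\nu,\nu'$ on $\mathscr A$ write $\nu\,\mathcal S\,\nu'$ if for every $E\in\mathscr A$ there is $F\in\mathscr A$, $F\subseteq E$, with $\nu(E)=\nu(F)$ and $\nu'(F)=0$. Suppose $\mu=\mu_1+\mu_2$, where $\mu_1$ is a purely atomic measure, $\mu_2$ is a non-atomic measure, $\mu_1\,\mathcal S\,\mu_2$ and $\mu_2\,\mathcal S\,\mu_1$. Let $K_0=\{f\in\mathcal M:\mu_1(X\setminus Z(f))=0\}$ and, for $f\in\mathcal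 M$, $K_f=f+K_0$. Then: 1. $K_0$ is a path connected subset of $\mathcal M_\delta$. 2. For every $\epsilon\in[0,1]\setminus\mu_1(\mathscr A)$, where $\mu_1(\mathscr A)=\{\mu_1(A):A\in\mathscr A\}$, the set $B_1(\epsilon)=\{f\in\mathcal M:\mu_1(X\setminus Z(f))<\epsilon\}$ is clopen in $\mathcal M_\delta$. 3. $K_0$ is the connected component of $0$ in $\mathcal M_\delta$. 4. For every $f\in\mathcal M$, $K_f=\{g\in\mathcal M:\mu_1(X\setminus Z(f-g))=0\}$, and $K_f$ is the connected component of $f$ in $\mathcal M_\delta$. 5. $K_0$ is the path component of $0$, and for every $f\in\mathcal M$ the set $K_f$ is the path component of $f$, in $\mathcal M_\delta$. -/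

import Mathlib

open MeasureTheory

/-- A measurable set `A` is an atom of `μ` if `μ A > 0` and every measurable `B` satisfies
`μ (A ∩ B) = 0` or `μ (A \ B) = 0`. (Mathlib's `NullSingletonClass` only speaks of singletons.) -/
def IsMeasureAtom {X : Type*} [MeasurableSpace X] (μ : Measure X) (A : Set X) : Prop :=
  MeasurableSet A ∧ 0 < μ A ∧ ∀ B : Set X, MeasurableSet B → μ (A ∩ B) = 0 ∨ μ (A \ B) = 0

/-- Every measurable set of positive measure contains an atom. -/
def PurelyAtomic {X : Type*} [MeasurableSpace X] (μ : Measure X) : Prop :=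
  ∀ E : Set X, MeasurableSet E → 0 < μ E → ∃ A : Set X, A ⊆ E ∧ IsMeasureAtom μ A

/-- There are no atoms. -/
def NonAtomic {X : Type*} [MeasurableSpace X] (μ : Measure X) : Prop :=
  ∀ A : Set X, ¬ IsMeasureAtom μ A

/-- `μ₁` is `𝒮`-singular with respect to `μ₂`. -/
def SSingular {X : Type*} [MeasurableSpace X] (μ₁ μ₂ : Measure X) : Prop :=
  ∀ E : Set X, MeasurableSet E →
    ∃ F : Set X, MeasurableSet F ∧ F ⊆ E ∧ μ₁ E = μ₁ F ∧ μ₂ F = 0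

/-- The ring of real-valued measurable functions on `X`, as a subring of all functions. -/
def measurableFunctionRing (X : Type*) [MeasurableSpace X] : Subring (X → ℝ) where
  carrier := {f | Measurable f}
  mul_mem' hf hg := Measurable.mul hf hg
  one_mem' := measurable_const
  add_mem' hf hg := Measurable.add hf hg
  zero_mem' := measurable_const
  neg_mem' hf := Measurable.neg hf

/-- The ring of measurable functions, to be equipped with the pseudometric coming from `μ`. -/
def MDelta {X : Type*} [MeasurableSpace X] (_μ : Measure X) : Type _ :=
  measurableFunctionRing X

namespace MDelta

variable {X : Type*} [MeasurableSpace X] {μ : Measure X}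

instance : CommRing (MDelta μ) := inferInstanceAs (CommRing (measurableFunctionRing X))

instance : CoeFun (MDelta μ) (fun _ => X → ℝ) := ⟨fun f => f.1⟩

/-- The zero set `Z(f)`. -/
def zeroSet (f : MDelta μ) : Set X := {x | f x = 0}

/-- The pseudo-rank function `N(f) = μ(X \ Z(f))`. -/
noncomputable def rank (f : MDelta μ) : ℝ := μ.real (zeroSet f)ᶜ

theorem compl_zeroSet_sub (f g : MDelta μ) : (zeroSet (f - g))ᶜ = {x | f x ≠ g x} := by
  ext x
  change ¬ (f x - g x = 0) ↔ f x ≠ g x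
  rw [sub_eq_zero]

/-- The pseudometric `δ(f, g) = μ(X \ Z(f - g))`; it induces the topology of `MDelta μ`. -/
noncomputable instance [IsProbabilityMeasure μ] : PseudoMetricSpace (MDelta μ) where
  dist f g := rank (f - g)
  dist_self f := by
    simp only [rank, compl_zeroSet_sub]
    simp
  dist_comm f g := by simp only [rank, compl_zeroSet_sub, ne_comm]
  dist_triangle f g h := by
    simp only [rank, compl_zeroSet_sub]
    refine le_trans (measureReal_mono ?_) (measureReal_union_le _ _)
    intro x hx
    by_contra hc
    simp only [Set.mem_union, Set.mem_ofPred_eq, not_or, not_not] at hc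
    exact hx (hc.1.trans hc.2)

/-- `K₀ = {f : μ₁(X \ Z(f)) = 0}`. -/
def K₀ (μ μ₁ : Measure X) : Set (MDelta μ) := {f | μ₁ (zeroSet f)ᶜ = 0}

/-- The translate `K_f = f + K₀`. -/
def K (μ μ₁ : Measure X) (f : MDelta μ) : Set (MDelta μ) := (fun h => f + h) '' K₀ μ μ₁

/-- `B₁(ε) = {f : μ₁(X \ Z(f)) < ε}`. -/
def B₁ (μ μ₁ : Measure X) (ε : ℝ) : Set (MDelta μ) := {f | μ₁.real (zeroSet f)ᶜ < ε}

end MDelta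

/-! Everything follows from `K f ⊆ pathComponent f ⊆ connectedComponent f ⊆ K f`. For the last
inclusion, on an atom `A` of `μ₁` the function `g ↦ μ₁(A ∩ {g ≠ f})` is 1-Lipschitz and takes only
the values `0` and `μ₁ A`, so its zero set is clopen. If `g ∉ K f`, some atom lies inside `{f ≠ g}`,
and its clopen set separates `f` from `g`. For the first, Sierpiński's theorem gives sets `E t`
increasing from `∅` to `X` with `μ₂ (E t)` linear in `t`. Replacing `f` by `g` on `E t` is a path;
since `{f ≠ g}` is `μ₁`-null, only `μ₂` contributes to distances, so the path is Lipschitz. -/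

namespace MeasureTheory

variable {X : Type*} [MeasurableSpace X]

/-- A chain of measurable sets whose distinct members have distinct measures, maximal in the sense
that every measurable set fails to be strictly comparable with some member. -/
structure IsMaxStrictChain (ν : Measure X) (C : Set (Set X)) : Prop where
  measurableSet : ∀ A ∈ C, MeasurableSet A
  subset_of_le : ∀ A ∈ C, ∀ B ∈ C, ν.real A ≤ ν.real B → A ⊆ B
  not_comparable : ∀ A, MeasurableSet A →
    ¬ ∀ D ∈ C, (A ⊆ D ∧ ν.real A < ν.real D) ∨ (D ⊆ A ∧ ν.real D < ν.real A)

/-- Hausdorff maximality for inclusion with strict increase of measure: a set comparable with every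
member would itself be a member, hence strictly comparable with itself. -/
theorem exists_isMaxStrictChain (ν : Measure X) : ∃ C, IsMaxStrictChain ν C := by
  let r : {A : Set X // MeasurableSet A} → {A : Set X // MeasurableSet A} → Prop :=
    fun A B => A.1 ⊆ B.1 ∧ ν.real A.1 < ν.real B.1
  obtain ⟨hchain, hmax⟩ := maxChain_spec (r := r)
  refine ⟨Subtype.val '' maxChain r, ?_, ?_, ?_⟩
  · rintro _ ⟨A, -, rfl⟩
    exact A.2
  · rintro _ ⟨A, hA, rfl⟩ _ ⟨B, hB, rfl⟩ hle
    rcases eq_or_ne A B with rfl | hne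
    · exact subset_rfl
    · rcases hchain hA hB hne with h | h
      · exact h.1
      · exact absurd h.2 hle.not_gt
  · intro A hA h
    have hins : IsChain r (insert ⟨A, hA⟩ (maxChain r)) :=
      hchain.insert fun D hD _ => h D.1 ⟨D, hD, rfl⟩
    have hmem : (⟨A, hA⟩ : {A : Set X // MeasurableSet A}) ∈ maxChain r := by
      rw [hmax hins (Set.subset_insert _ _)]
      exact Set.mem_insert _ _
    rcases h A ⟨_, hmem, rfl⟩ with h | h <;> exact lt_irrefl _ h.2

namespace IsMaxStrictChain

variable {ν : Measure X} [IsFiniteMeasure ν] {C : Set (Set X)}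

/-- The union of an increasing sequence of members realizes the supremum of the measures at most
`t`. Were the supremum not attained in `C`, this union would be strictly comparable with every
member. -/
theorem exists_greatest_le (hC : IsMaxStrictChain ν C) {t : ℝ} (ht : 0 ≤ t) :
    ∃ A ∈ C, ν.real A ≤ t ∧ ∀ D ∈ C, ν.real D ≤ t → ν.real D ≤ ν.real A := by
  let S : Set ℝ := {r | ∃ D ∈ C, ν.real D ≤ t ∧ ν.real D = r}
  have hbdd : BddAbove S := ⟨t, by rintro _ ⟨D, -, hD, rfl⟩; exact hD⟩
  have hne : S.Nonempty := by
    by_contra hemp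
    refine hC.not_comparable ∅ MeasurableSet.empty fun D hD => Or.inl ⟨Set.empty_subset _, ?_⟩
    rw [measureReal_empty]
    by_contra hlt
    exact hemp ⟨_, D, hD, (not_lt.1 hlt).trans ht, rfl⟩
  obtain ⟨u, hu, hlim, huS⟩ := exists_seq_tendsto_sSup hne hbdd
  choose D hDC hDt hDu using huS
  have hmono : Monotone D := fun m n hmn =>
    hC.subset_of_le _ (hDC m) _ (hDC n) (by rw [hDu, hDu]; exact hu hmn)
  have hA : ν.real (⋃ n, D n) = sSup S := by
    have h := (ENNReal.tendsto_toReal (measure_ne_top ν _)).comp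
      (tendsto_measure_iUnion_atTop (μ := ν) hmono)
    refine tendsto_nhds_unique h (hlim.congr fun n => (hDu n).symm)
  have hSt : sSup S ≤ t := csSup_le hne (by rintro _ ⟨D, -, hD, rfl⟩; exact hD)
  by_contra hnot
  have hlt : ∀ E ∈ C, ν.real E ≤ t → ν.real E < sSup S := by
    intro E hE hEt
    refine lt_of_le_of_ne (le_csSup hbdd ⟨E, hE, hEt, rfl⟩) fun heq => hnot ⟨E, hE, hEt, ?_⟩
    intro F hF hFt
    rw [heq]
    exact le_csSup hbdd ⟨F, hF, hFt, rfl⟩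
  refine hC.not_comparable (⋃ n, D n) (.iUnion fun n => hC.measurableSet _ (hDC n)) fun E hE => ?_
  rw [hA]
  rcases le_or_gt (ν.real E) t with hEt | hEt
  · obtain ⟨n, hn⟩ := (hlim.eventually (lt_mem_nhds (hlt E hE hEt))).exists
    refine Or.inr ⟨(hC.subset_of_le _ hE _ (hDC n) ?_).trans (Set.subset_iUnion D n), hlt E hE hEt⟩
    rw [hDu]
    exact hn.le
  · exact Or.inl ⟨Set.iUnion_subset fun n =>
      hC.subset_of_le _ (hDC n) _ hE ((hDt n).trans hEt.le), hSt.trans_lt hEt⟩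

theorem exists_least_ge (hC : IsMaxStrictChain ν C) {t : ℝ} (ht : t ≤ ν.real Set.univ) :
    ∃ B ∈ C, t ≤ ν.real B ∧ ∀ D ∈ C, t ≤ ν.real D → ν.real B ≤ ν.real D := by
  let S : Set ℝ := {r | ∃ D ∈ C, t ≤ ν.real D ∧ ν.real D = r}
  have hbdd : BddBelow S := ⟨t, by rintro _ ⟨D, -, hD, rfl⟩; exact hD⟩
  have hne : S.Nonempty := by
    by_contra hemp
    refine hC.not_comparable Set.univ .univ fun D hD => Or.inr ⟨Set.subset_univ _, ?_⟩
    by_contra hlt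
    exact hemp ⟨_, D, hD, ht.trans (not_lt.1 hlt), rfl⟩
  obtain ⟨u, hu, hlim, huS⟩ := exists_seq_tendsto_sInf hne hbdd
  choose D hDC hDt hDu using huS
  have hanti : Antitone D := fun m n hmn =>
    hC.subset_of_le _ (hDC n) _ (hDC m) (by rw [hDu, hDu]; exact hu hmn)
  have hA : ν.real (⋂ n, D n) = sInf S := by
    have h := (ENNReal.tendsto_toReal (measure_ne_top ν _)).comp
      (tendsto_measure_iInter_atTop (μ := ν)
        (fun n => (hC.measurableSet _ (hDC n)).nullMeasurableSet) hanti ⟨0, measure_ne_top ν _⟩)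
    refine tendsto_nhds_unique h (hlim.congr fun n => (hDu n).symm)
  have hSt : t ≤ sInf S := le_csInf hne (by rintro _ ⟨D, -, hD, rfl⟩; exact hD)
  by_contra hnot
  have hlt : ∀ E ∈ C, t ≤ ν.real E → sInf S < ν.real E := by
    intro E hE hEt
    refine lt_of_le_of_ne (csInf_le hbdd ⟨E, hE, hEt, rfl⟩) fun heq => hnot ⟨E, hE, hEt, ?_⟩
    intro F hF hFt
    rw [← heq]
    exact csInf_le hbdd ⟨F, hF, hFt, rfl⟩
  refine hC.not_comparable (⋂ n, D n) (.iInter fun n => hC.measurableSet _ (hDC n)) fun E hE => ?_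
  rw [hA]
  rcases le_or_gt t (ν.real E) with hEt | hEt
  · obtain ⟨n, hn⟩ := (hlim.eventually (gt_mem_nhds (hlt E hE hEt))).exists
    refine Or.inl ⟨(Set.iInter_subset D n).trans (hC.subset_of_le _ (hDC n) _ hE ?_), hlt E hE hEt⟩
    rw [hDu]
    exact hn.le
  · exact Or.inr ⟨Set.subset_iInter fun n =>
      hC.subset_of_le _ hE _ (hDC n) (hEt.le.trans (hDt n)), hEt.trans_le hSt⟩

end IsMaxStrictChain

end MeasureTheory

theorem NonAtomic.exists_subset_measureReal_lt {X : Type*} [MeasurableSpace X] {ν : Measure X}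
    [IsFiniteMeasure ν] (hν : NonAtomic ν) {E : Set X} (hE : MeasurableSet E)
    (hpos : 0 < ν.real E) :
    ∃ D ⊆ E, MeasurableSet D ∧ 0 < ν.real D ∧ ν.real D < ν.real E := by
  have hE0 : 0 < ν E := (ENNReal.toReal_pos_iff.1 hpos).1
  have h := hν E
  simp only [IsMeasureAtom, hE, hE0, true_and, not_forall, not_or] at h
  obtain ⟨B, hB, h₁, h₂⟩ := h
  refine ⟨E ∩ B, Set.inter_subset_left, hE.inter hB, ?_, ?_⟩
  · exact ENNReal.toReal_pos h₁ (measure_ne_top ν _)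
  · have := measureReal_inter_add_sdiff (μ := ν) (s := E) hB
    have : 0 < ν.real (E \ B) := ENNReal.toReal_pos h₂ (measure_ne_top ν _)
    linarith

/-- A maximal strict chain of a nonatomic finite measure takes all intermediate values. -/
theorem MeasureTheory.IsMaxStrictChain.exists_measureReal_eq {X : Type*} [MeasurableSpace X]
    {ν : Measure X} [IsFiniteMeasure ν] {C : Set (Set X)} (hC : IsMaxStrictChain ν C)
    (hν : NonAtomic ν) {t : ℝ} (h0 : 0 ≤ t) (ht : t ≤ ν.real Set.univ) :
    ∃ A ∈ C, ν.real A = t := by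
  obtain ⟨A, hA, hAt, hAmax⟩ := hC.exists_greatest_le h0
  obtain ⟨B, hB, hBt, hBmin⟩ := hC.exists_least_ge ht
  have hAB : A ⊆ B := hC.subset_of_le _ hA _ hB (hAt.trans hBt)
  have hdiff : ν.real (B \ A) = ν.real B - ν.real A :=
    measureReal_sdiff hAB (hC.measurableSet A hA)
  rcases hAt.eq_or_lt with h | hlt
  · exact ⟨A, hA, h⟩
  -- Otherwise `A` and `B` bound a gap in the chain around `t`. Splitting `B \ A` puts `A ∪ D`
  -- strictly inside the gap, contradicting maximality.
  obtain ⟨D, hD, hDm, hD0, hD1⟩ := hν.exists_subset_measureReal_lt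
    ((hC.measurableSet B hB).diff (hC.measurableSet A hA)) (by linarith)
  have hAD : ν.real (A ∪ D) = ν.real A + ν.real D :=
    measureReal_union (Set.disjoint_sdiff_right.mono_right hD) hDm
  refine absurd (fun E hE => ?_) (hC.not_comparable (A ∪ D) ((hC.measurableSet A hA).union hDm))
  rcases le_total (ν.real E) t with h | h
  · have := hAmax E hE h
    exact Or.inr ⟨(hC.subset_of_le _ hE _ hA this).trans Set.subset_union_left, by linarith⟩
  · have := hBmin E hE h
    refine Or.inl ⟨(Set.union_subset hAB (hD.trans Set.sdiff_subset)).trans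
      (hC.subset_of_le _ hB _ hE this), by linarith⟩

/-- Sierpiński: a nonatomic finite measure admits an increasing family of measurable sets from `∅`
to the whole space whose measure grows linearly. -/
theorem NonAtomic.exists_monotone_family {X : Type*} [MeasurableSpace X] {ν : Measure X}
    [IsFiniteMeasure ν] (hν : NonAtomic ν) :
    ∃ E : unitInterval → Set X, Monotone E ∧ (∀ t, MeasurableSet (E t)) ∧ E 0 = ∅ ∧
      E 1 = Set.univ ∧ ∀ t, ν.real (E t) = t * ν.real Set.univ := by
  obtain ⟨C, hC⟩ := exists_isMaxStrictChain ν
  have hM : 0 ≤ ν.real Set.univ := measureReal_nonneg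
  choose F hFC hF using fun t : unitInterval => hC.exists_measureReal_eq hν
    (mul_nonneg t.2.1 hM) (mul_le_of_le_one_left hM t.2.2)
  have hFmono : Monotone F := fun s t hst => hC.subset_of_le _ (hFC s) _ (hFC t) (by
    rw [hF, hF]
    exact mul_le_mul_of_nonneg_right hst hM)
  classical
  -- The ends are reset because chain members of measure zero or full measure may differ from `∅`
  -- and `X` by null sets.
  refine ⟨fun t => if t = 0 then ∅ else if t = 1 then Set.univ else F t, ?_, ?_, ?_, ?_, ?_⟩
  · intro s t hst
    dsimp only
    by_cases hs : s = 0
    · simp [hs]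
    have ht : t ≠ 0 := fun h => hs (le_antisymm (h ▸ hst) s.2.1)
    by_cases ht1 : t = 1
    · simp [ht1]
    have hs1 : s ≠ 1 := fun h => ht1 (le_antisymm t.2.2 (h ▸ hst))
    simpa [hs, ht, ht1, hs1] using hFmono hst
  · intro t
    dsimp only
    split_ifs
    exacts [.empty, .univ, hC.measurableSet _ (hFC t)]
  · simp
  · simp
  · intro t
    dsimp only
    split_ifs with h h'
    · simp [h]
    · simp [h']
    · exact hF t

/-! ### Clopen sets and paths in `MDelta μ` -/

namespace MDelta

variable {X : Type*} [MeasurableSpace X] {μ : Measure X}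

theorem measurableSet_ne (f g : MDelta μ) : MeasurableSet {x | f x ≠ g x} :=
  (measurableSet_eq_fun f.2 g.2).compl

theorem dist_eq [IsProbabilityMeasure μ] (f g : MDelta μ) : dist f g = μ.real {x | f x ≠ g x} := by
  rw [← compl_zeroSet_sub]
  rfl

theorem compl_zeroSet (f : MDelta μ) : (zeroSet f)ᶜ = {x | f x ≠ (0 : MDelta μ) x} := rfl

theorem K_eq (ν : Measure X) (f : MDelta μ) : K μ ν f = {g | ν {x | f x ≠ g x} = 0} := by
  ext g
  constructor
  · rintro ⟨h, hh, rfl⟩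
    refine (congrArg ν ?_).trans hh
    ext x
    change f x ≠ f x + h x ↔ ¬ h x = 0
    simp
  · intro hg
    refine ⟨g - f, ?_, add_sub_cancel f g⟩
    change ν (zeroSet (g - f))ᶜ = 0
    rw [compl_zeroSet_sub]
    simpa only [ne_comm, Set.mem_ofPred_eq] using hg

theorem K_zero (ν : Measure X) : K μ ν 0 = K₀ μ ν := by
  simp [K]

/-- The measure of `{g ≠ f}` inside a fixed set is a continuous function of `g`. -/
theorem continuous_measureReal_inter [IsProbabilityMeasure μ] {ν : Measure X} (hν : ν ≤ μ)
    (A : Set X) (f : MDelta μ) :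
    Continuous fun g : MDelta μ => ν.real (A ∩ {x | g x ≠ f x}) := by
  have : IsFiniteMeasure ν := isFiniteMeasure_of_le μ hν
  refine LipschitzWith.continuous (K := 1) (LipschitzWith.of_le_add fun g h => ?_)
  have hsub : A ∩ {x | g x ≠ f x} ⊆ (A ∩ {x | h x ≠ f x}) ∪ {x | g x ≠ h x} := by
    rintro x ⟨hxA, hx⟩
    by_cases hgh : g x = h x
    · exact Or.inl ⟨hxA, fun hh => hx (hgh.trans hh)⟩
    · exact Or.inr hgh
  calc ν.real (A ∩ {x | g x ≠ f x})
      ≤ ν.real (A ∩ {x | h x ≠ f x}) + ν.real {x | g x ≠ h x} :=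
        (measureReal_mono hsub).trans (measureReal_union_le _ _)
    _ ≤ ν.real (A ∩ {x | h x ≠ f x}) + dist g h := by
        rw [dist_eq]
        gcongr
        exact ENNReal.toReal_mono (measure_ne_top μ _) (hν _)

/-- As `ε` is not a value of `ν`, the conditions `< ε` and `≤ ε` coincide. -/
theorem isClopen_B₁ [IsProbabilityMeasure μ] {ν : Measure X} (hν : ν ≤ μ) {ε : ℝ}
    (hε : ∀ A, MeasurableSet A → ν.real A ≠ ε) : IsClopen (B₁ μ ν ε) := by
  have hcont : Continuous fun g : MDelta μ => ν.real (zeroSet g)ᶜ := by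
    simpa only [compl_zeroSet, Set.univ_inter] using
      continuous_measureReal_inter hν Set.univ (0 : MDelta μ)
  refine ⟨?_, isOpen_lt hcont continuous_const⟩
  have : B₁ μ ν ε = {g | ν.real (zeroSet g)ᶜ ≤ ε} := by
    ext g
    exact (Ne.le_iff_lt (hε _ (measurableSet_ne g 0))).symm
  rw [this]
  exact isClosed_le hcont continuous_const

/-- The functions agreeing with `f` almost everywhere on an atom form a clopen set. -/
theorem isClopen_setOf_ae_eq_on_atom [IsProbabilityMeasure μ] {ν : Measure X} (hν : ν ≤ μ)
    {A : Set X} (hA : IsMeasureAtom ν A) (f : MDelta μ) :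
    IsClopen {g : MDelta μ | ν.real (A ∩ {x | g x ≠ f x}) = 0} := by
  have : IsFiniteMeasure ν := isFiniteMeasure_of_le μ hν
  have hcont := continuous_measureReal_inter hν A f
  have hpos : 0 < ν.real A := ENNReal.toReal_pos hA.2.1.ne' (measure_ne_top ν _)
  refine ⟨isClosed_eq hcont continuous_const, ?_⟩
  -- An atom leaves no value strictly between `0` and `ν A`, so the closed condition is also open.
  have : {g : MDelta μ | ν.real (A ∩ {x | g x ≠ f x}) = 0} =
      {g | ν.real (A ∩ {x | g x ≠ f x}) < ν.real A} := by
    ext g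
    constructor
    · intro hg
      exact lt_of_eq_of_lt hg hpos
    · intro hg
      rcases hA.2.2 _ (measurableSet_ne g f) with h | h
      · exact (measureReal_eq_zero_iff (measure_ne_top ν _)).2 h
      · refine absurd ?_ (ne_of_lt (Set.mem_ofPred_eq ▸ hg))
        have := measureReal_inter_add_sdiff (μ := ν) (s := A) (measurableSet_ne g f)
        rwa [(measureReal_eq_zero_iff (measure_ne_top ν _)).2 h, add_zero] at this
  rw [this]
  exact isOpen_lt hcont continuous_const

theorem connectedComponent_subset_K [IsProbabilityMeasure μ] {ν : Measure X} (hν : ν ≤ μ)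
    (hatom : PurelyAtomic ν) (f : MDelta μ) : connectedComponent f ⊆ K μ ν f := by
  have : IsFiniteMeasure ν := isFiniteMeasure_of_le μ hν
  intro g hg
  rw [K_eq]
  by_contra hne
  obtain ⟨A, hAsub, hA⟩ := hatom _ (measurableSet_ne f g) (pos_iff_ne_zero.2 hne)
  have hgU := (isClopen_setOf_ae_eq_on_atom hν hA f).connectedComponent_subset (x := f)
    (by simp) hg
  -- Here `g ≠ f` on all of `A`, so membership in the clopen set would force `ν A = 0`.
  have hinter : A ∩ {x | g x ≠ f x} = A :=
    Set.inter_eq_left.2 fun x hx => Ne.symm (hAsub hx)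
  rw [Set.mem_ofPred_eq, hinter, measureReal_eq_zero_iff (measure_ne_top ν _)] at hgU
  exact hA.2.1.ne' hgU

theorem joinedIn_K {μ₁ μ₂ : Measure X} [IsProbabilityMeasure μ] (hμ : μ = μ₁ + μ₂)
    (h₂ : NonAtomic μ₂) {f g : MDelta μ} (hg : g ∈ K μ μ₁ f) : JoinedIn (K μ μ₁ f) f g := by
  have : IsFiniteMeasure μ₂ :=
    isFiniteMeasure_of_le μ (hμ ▸ Measure.le_add_left le_rfl)
  classical
  obtain ⟨E, hmono, hmeas, hE0, hE1, hE⟩ := h₂.exists_monotone_family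
  rw [K_eq] at hg ⊢
  let γ : unitInterval → MDelta μ := fun t =>
    ⟨fun x => if x ∈ E t then g x else f x, Measurable.ite (hmeas t) g.2 f.2⟩
  have hγ : ∀ t x, γ t x = if x ∈ E t then g x else f x := fun _ _ => rfl
  have hle : ∀ s t, s ≤ t → dist (γ s) (γ t) ≤ μ₂.real Set.univ * dist s t := by
    intro s t hst
    have hsub₁ : {x | γ s x ≠ γ t x} ⊆ {x | f x ≠ g x} := by
      intro x hx hfg
      exact hx (by simp [hγ, hfg])
    have hsub₂ : {x | γ s x ≠ γ t x} ⊆ E t \ E s := by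
      intro x hx
      by_contra hxE
      refine hx ?_
      by_cases hs : x ∈ E s
      · simp [hγ, hs, hmono hst hs]
      · have ht : x ∉ E t := fun ht => hxE ⟨ht, hs⟩
        simp [hγ, hs, ht]
    -- The `μ₁` part vanishes because the path only changes values on `{f ≠ g}`.
    have hμle : μ {x | γ s x ≠ γ t x} ≤ μ₂ (E t \ E s) := by
      rw [hμ, Measure.add_apply, measure_mono_null hsub₁ hg, zero_add]
      exact measure_mono hsub₂
    calc dist (γ s) (γ t) = μ.real {x | γ s x ≠ γ t x} := dist_eq _ _
      _ ≤ μ₂.real (E t \ E s) := ENNReal.toReal_mono (measure_ne_top _ _) hμle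
      _ = μ₂.real Set.univ * (t - s) := by
        rw [measureReal_sdiff (hmono hst) (hmeas s), hE, hE]
        ring
      _ = μ₂.real Set.univ * dist s t := by
        rw [dist_comm, Subtype.dist_eq, Real.dist_eq, abs_of_nonneg (sub_nonneg.2 (Subtype.coe_le_coe.2 hst))]
  have hlip : LipschitzWith (μ₂.real Set.univ).toNNReal γ := by
    refine LipschitzWith.of_dist_le_mul fun s t => ?_
    rw [Real.coe_toNNReal _ measureReal_nonneg]
    rcases le_total s t with h | h
    · exact hle s t h
    · rw [dist_comm, dist_comm s]
      exact hle t s h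
  refine ⟨⟨⟨γ, hlip.continuous⟩, ?_, ?_⟩, fun t => ?_⟩
  · exact Subtype.ext (funext fun x => (hγ 0 x).trans (by simp [hE0]))
  · exact Subtype.ext (funext fun x => (hγ 1 x).trans (by simp [hE1]))
  · have hsub : {x | f x ≠ γ t x} ⊆ {x | f x ≠ g x} := by
      intro x hx hfg
      exact hx (by simp [hγ, hfg])
    exact measure_mono_null hsub hg

theorem self_mem_K (ν : Measure X) (f : MDelta μ) : f ∈ K μ ν f := by
  rw [K_eq]
  simp

theorem connectedComponent_eq_K {μ₁ μ₂ : Measure X} [IsProbabilityMeasure μ] (hμ : μ = μ₁ + μ₂)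
    (h₁ : PurelyAtomic μ₁) (h₂ : NonAtomic μ₂) (f : MDelta μ) :
    connectedComponent f = K μ μ₁ f :=
  (connectedComponent_subset_K (hμ ▸ Measure.le_add_right le_rfl) h₁ f).antisymm fun _ hg =>
    pathComponent_subset_component f (joinedIn_K hμ h₂ hg).joined

theorem pathComponent_eq_K {μ₁ μ₂ : Measure X} [IsProbabilityMeasure μ] (hμ : μ = μ₁ + μ₂)
    (h₁ : PurelyAtomic μ₁) (h₂ : NonAtomic μ₂) (f : MDelta μ) :
    pathComponent f = K μ μ₁ f :=
  ((pathComponent_subset_component f).trans (connectedComponent_eq_K hμ h₁ h₂ f).subset).antisymm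
    fun _ hg => (joinedIn_K hμ h₂ hg).joined

end MDelta

theorem theorem3p8 {X : Type*} [MeasurableSpace X]
    (μ μ₁ μ₂ : MeasureTheory.Measure X) [MeasureTheory.IsProbabilityMeasure μ]
    (hμ : μ = μ₁ + μ₂) (h₁ : PurelyAtomic μ₁) (h₂ : NonAtomic μ₂)
    (h₁₂ : SSingular μ₁ μ₂) (h₂₁ : SSingular μ₂ μ₁) :
    IsPathConnected (MDelta.K₀ μ μ₁) ∧
    (∀ ε ∈ Set.Icc (0 : ℝ) 1, ε ∉ {r : ℝ | ∃ A : Set X, MeasurableSet A ∧ μ₁.real A = r} →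
      IsClopen (MDelta.B₁ μ μ₁ ε)) ∧
    connectedComponent (0 : MDelta μ) = MDelta.K₀ μ μ₁ ∧
    (∀ f : MDelta μ,
      MDelta.K μ μ₁ f = {g : MDelta μ | μ₁ (MDelta.zeroSet (f - g))ᶜ = 0} ∧
      connectedComponent f = MDelta.K μ μ₁ f) ∧
    pathComponent (0 : MDelta μ) = MDelta.K₀ μ μ₁ ∧
    (∀ f : MDelta μ, pathComponent f = MDelta.K μ μ₁ f) := by
  have hpath : IsPathConnected (MDelta.K₀ μ μ₁) := by
    rw [← MDelta.K_zero]
    exact ⟨0, MDelta.self_mem_K μ₁ 0, fun _ hg => MDelta.joinedIn_K hμ h₂ hg⟩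
  refine ⟨hpath, ?_, ?_, fun f => ⟨?_, MDelta.connectedComponent_eq_K hμ h₁ h₂ f⟩, ?_,
    fun f => MDelta.pathComponent_eq_K hμ h₁ h₂ f⟩
  · intro ε _ hε
    exact MDelta.isClopen_B₁ (hμ ▸ Measure.le_add_right le_rfl) fun A hA h => hε ⟨A, hA, h⟩
  · rw [MDelta.connectedComponent_eq_K hμ h₁ h₂, MDelta.K_zero]
  · simp only [MDelta.K_eq, MDelta.compl_zeroSet_sub]
  · rw [MDelta.pathComponent_eq_K hμ h₁ h₂, MDelta.K_zero]
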